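/- Let $\Sigma$ be a finite alphabet with at least two symbols. A probabilistic finite automaton (PFA) over $\Sigma$ consists of non-empty finite sets $R$ of input states and $W$ of output states, transition probabilities $\mu_R(q,a,p)\ge 0$ for $q\in R$, $a\in\Sigma$, $p\in R\cup W$ with $\sum_{p}\mu_R(q,a,p)=1$, transition probabilities $\mu_W(q,a,p)\ge 0$ for $q\in W$, $a\in\Sigma$, $p\in R\cup W$ with $\sum_{a,p}\mu_W(q,a,p)=1$, and an initial distribution $\sigma$ on $R\cup W$. In an input state $q$ the PFA reads the next input symbol $a$ and moves to $p$ with probability $\mu_R(q,a,p)$; in an output state $q$, with probability $\mu_W(q,a,p)$, it writes $a$ and moves to $p$. For an infinite input string $t\in\Sigma^\omega$, let $X(t)$ be the random (finite or infinite) string written by the infinite computation of $X$ on $t$. For $S\subseteq\Sigma^\omega$, the smoothed trie height is \[ H(S,n,X)=\sup_{A\subseteq S,\ |A|=n}\ \mathbb E\Bigl[\max_{t,t'\in A,\ t\ne t'}\mathrm{lcp}\bigl(X(t),X(t')\bigr)\Bigr]\in[0,\infty], \] where the strings $X(t)$, $t\in A$, are independent, $\mathrm{lcp}$ is the length of the longest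 common prefix, and the maximum over the empty set is $0$. Let $X=(\{s\},W,\mu_R,\mu_W,\sigma)$ be a PFA over $\Sigma$ that is star-like, i.e. it has a single input state $s$, $\mu_W(q,a,q')=0$ for all $q\neq q'$ in $W$ and $a\in\Sigma$, and $\sum_{a}\mu_W(q,a,q)<1$ for all $q\in W$. Suppose that $X$ is read-semi-deterministic, i.e. for every $a\in\Sigma$ there is exactly one output state $q_a$ with $\mu_R(s,a,q_a)=1-\mu_R(s,a,s)$; that $X$ is in canonical form, i.e. $\sigma(s)=1$; and that $\mu_R(s,a,s)<1$ for at least one $a\in\Sigma$. Let \[ P=\max_{a\in\Sigma}\sum_{b\in\Sigma}\bigl(\mu_W(q_a,b,q_a)+\mu_W(q_a,b,s)\bigr)^2. \] If $P<1$, then for every $\varepsilon>0$, \[ H(\Sigma^\omega,n,X)\ \ge\ 2(1-\varepsilon)\log_{1/P} n-o(1)\qquad(n\to\infty). \] If $P=1$ (where $\log_{1/P}n$ is read as $+\infty$), then $H(\Sigma^\omega,n,X)=\infty$ for every $n\ge 2$. -/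

import Mathlib

open MeasureTheory ProbabilityTheory
open scoped ENNReal

noncomputable section

/-- A (Mealy-type) probabilistic finite automaton over the alphabet `α`, with input states `R` and
output states `W`. In input state `q`, on reading the symbol `a`, it moves to `p` with probability
`readProb q a p`. In output state `q`, it writes the symbol `a` and moves to `p` with probability
`writeProb q a p`; hence `writeProb q` is a probability distribution on pairs (symbol, state). -/
structure PFA (α R W : Type*) [Fintype α] [Fintype R] [Fintype W] where
  nonempty_input : Nonempty R
  nonempty_output : Nonempty W
  readProb : R → α → R ⊕ W → ℝ
  readProb_nonneg : ∀ q a p, 0 ≤ readProb q a p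
  readProb_sum : ∀ q a, ∑ p, readProb q a p = 1
  writeProb : W → α → R ⊕ W → ℝ
  writeProb_nonneg : ∀ q a p, 0 ≤ writeProb q a p
  writeProb_sum : ∀ q, ∑ a, ∑ p, writeProb q a p = 1
  init : R ⊕ W → ℝ
  init_nonneg : ∀ p, 0 ≤ init p
  init_sum : ∑ p, init p = 1

/-- The probability mass function with given nonnegative real weights of total mass one. -/
def pmfOfReal {ι : Type*} [Fintype ι] (f : ι → ℝ) (h0 : ∀ i, 0 ≤ f i) (h1 : ∑ i, f i = 1) :
    PMF ι :=
  PMF.ofFintype (fun i => ENNReal.ofReal (f i)) (by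
    rw [← ENNReal.ofReal_sum_of_nonneg (fun i _ => h0 i), h1, ENNReal.ofReal_one])

/-- A configuration of a computation: the number of input symbols read so far, the current state,
and the symbol written in the step that led to this configuration (if there was one). -/
structure Config (α R W : Type*) where
  pos : ℕ
  state : R ⊕ W
  emitted : Option α

instance {α R W : Type*} : MeasurableSpace (Config α R W) := ⊤

/-- The first `k` steps of an infinite computation write this finite string
(the configuration at time `0` has no preceding step). -/
def writtenList {α R W : Type*} (ω : ℕ → Config α R W) (k : ℕ) : List α :=
  (List.range k).filterMap (fun i => (ω (i + 1)).emitted)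

open Classical in
/-- The finite or infinite output string of an infinite computation: its `n`-th symbol is the
`n`-th symbol that is written, if at least `n + 1` symbols are ever written. -/
def outputString {α R W : Type*} (ω : ℕ → Config α R W) : Stream'.Seq α :=
  ⟨fun n => if h : ∃ k, n < (writtenList ω k).length
      then (writtenList ω (Nat.find h))[n]? else none, by
    intro n hn
    by_cases h : ∃ k, n < (writtenList ω k).length
    · simp only [h, dif_pos] at hn
      exact absurd (List.getElem?_eq_none_iff.mp hn) (not_le.mpr (Nat.find_spec h))
    · have h' : ¬ ∃ k, n + 1 < (writtenList ω k).length :=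
        fun ⟨k, hk⟩ => h ⟨k, by omega⟩
      simp only [h', dif_neg, not_false_iff]⟩

/-- The length of the longest common prefix of two finite or infinite strings. -/
def lcp {α : Type*} (u v : Stream'.Seq α) : ℕ∞ :=
  ⨆ (m : ℕ) (_ : ∀ i < m, u.get? i = v.get? i ∧ u.get? i ≠ none), (m : ℕ∞)

namespace PFA

variable {α R W : Type*} [Fintype α] [Fintype R] [Fintype W]

/-- The distribution of the first state. -/
def initPMF (X : PFA α R W) : PMF (R ⊕ W) :=
  pmfOfReal X.init X.init_nonneg X.init_sum

/-- The distribution of the next state when the symbol `a` is read in the input state `q`. -/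
def readPMF (X : PFA α R W) (q : R) (a : α) : PMF (R ⊕ W) :=
  pmfOfReal (X.readProb q a) (X.readProb_nonneg q a) (X.readProb_sum q a)

/-- The joint distribution of the written symbol and the next state in the output state `q`. -/
def writePMF (X : PFA α R W) (q : W) : PMF (α × (R ⊕ W)) :=
  pmfOfReal (fun x => X.writeProb q x.1 x.2) (fun x => X.writeProb_nonneg q x.1 x.2)
    (by rw [Fintype.sum_prod_type]; exact X.writeProb_sum q)

/-- One step of the computation on the infinite input string `t`. -/
def step (X : PFA α R W) (t : ℕ → α) (c : Config α R W) : PMF (Config α R W) :=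
  match c.state with
  | Sum.inl q => (X.readPMF q (t c.pos)).map (fun p => ⟨c.pos + 1, p, none⟩)
  | Sum.inr q => (X.writePMF q).map (fun x => ⟨c.pos, x.2, some x.1⟩)

/-- The transition kernel of the Markov chain of configurations on the input string `t`. -/
def stepKernel (X : PFA α R W) (t : ℕ → α) : Kernel (Config α R W) (Config α R W) :=
  ⟨fun c => (X.step t c).toMeasure, measurable_from_top⟩

instance (X : PFA α R W) (t : ℕ → α) : IsMarkovKernel (X.stepKernel t) :=
  ⟨fun c => PMF.toMeasure.isProbabilityMeasure (X.step t c)⟩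

/-- The law of the configuration at time `0`. -/
def initMeasure (X : PFA α R W) : Measure (Config α R W) :=
  (X.initPMF.map (fun p => (⟨0, p, none⟩ : Config α R W))).toMeasure

instance (X : PFA α R W) : IsProbabilityMeasure X.initMeasure :=
  PMF.toMeasure.isProbabilityMeasure _

/-- The law of the (infinite) computation of `X` on the infinite input string `t`: the law of the
Markov chain of configurations. The random string `X(t)` is `outputString` under this law. -/
def computation (X : PFA α R W) (t : ℕ → α) : Measure (ℕ → Config α R W) :=
  Kernel.trajMeasure (X := fun _ => Config α R W) X.initMeasure
    (fun n => (X.stepKernel t).comap (fun c => c ⟨n, Finset.mem_Iic.mpr le_rfl⟩)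
      (measurable_pi_apply _))

instance (X : PFA α R W) (t : ℕ → α) : IsProbabilityMeasure (X.computation t) := by
  unfold computation; infer_instance

/-- The smoothed trie height `H(S, n, X)`: the maximum (supremum), over all sets `A ⊆ S` of `n`
infinite strings, of the expected height of the trie of the strings `X(s)`, `s ∈ A`, which are
perturbed independently. The height is the largest length of a common prefix of the perturbations
of two different members of `A`. -/
def smoothedTrieHeight (X : PFA α R W) (S : Set (ℕ → α)) (n : ℕ) : ℝ≥0∞ :=
  ⨆ (A : Finset (ℕ → α)) (_ : (A : Set (ℕ → α)) ⊆ S) (_ : A.card = n),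
    ∫⁻ ω : A → ℕ → Config α R W,
      (⨆ (u : A) (v : A) (_ : u ≠ v),
        ((lcp (outputString (ω u)) (outputString (ω v)) : ℕ∞) : ℝ≥0∞))
      ∂(Measure.pi fun u : A => X.computation u.1)

/-- `X` is star-like with unique input state `s`. -/
structure IsStarLike (X : PFA α R W) (s : R) : Prop where
  unique_input : ∀ r : R, r = s
  no_move : ∀ q q' : W, q ≠ q' → ∀ a, X.writeProb q a (Sum.inr q') = 0
  loop_lt_one : ∀ q : W, ∑ a, X.writeProb q a (Sum.inr q) < 1

/-- A star-like `X` is read-semi-deterministic: with `p_a` the probability of a loop at `s` on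
reading `a`, exactly one output state `q_a` is entered with probability `1 - p_a`. -/
structure IsReadSemiDeterministic (X : PFA α R W) (s : R) : Prop extends X.IsStarLike s where
  existsUnique_target : ∀ a : α,
    ∃! q : W, X.readProb s a (Sum.inr q) = 1 - X.readProb s a (Sum.inl s)

/-- Canonical form: computations start in `s` with probability one. -/
def IsCanonical (X : PFA α R W) (s : R) : Prop :=
  X.init (Sum.inl s) = 1 ∧ ∀ q : W, X.init (Sum.inr q) = 0

/-- The output state `q_a`. -/
def target {X : PFA α R W} {s : R} (hX : X.IsReadSemiDeterministic s) (a : α) : W :=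
  (hX.existsUnique_target a).choose

/-- `P = max_a ∑_b (μ_W(q_a, b, q_a) + μ_W(q_a, b, s))²`. -/
def coincidence [Nonempty α] {X : PFA α R W} {s : R} (hX : X.IsReadSemiDeterministic s) : ℝ :=
  Finset.univ.sup' Finset.univ_nonempty fun a : α =>
    ∑ b, (X.writeProb (target hX a) b (Sum.inr (target hX a))
      + X.writeProb (target hX a) b (Sum.inl s)) ^ 2

end PFA

end

/-! Use inputs that all begin with the same long run of a letter `a` that is not always deleted and
whose output state `q` has letter law with sum of squares `P`. On such a run the machine moves only
between `s` and `q`, and the next letter has the same law `letterProb` from either, so the written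
symbols are i.i.d. The only defect is the waiting time in `s`: allowing `K` readings per letter
costs a factor `(1 - p ^ K) ^ m` per output, where `p < 1` is the loop probability
(`le_computation_prefix`). With `n` and `m` fixed this factor tends to one as `K` grows. Hence the
first `m` symbols of the `n` outputs behave like `n` independent draws from a product law on words;
a coincidence of two draws gives a common prefix of length `m`, so the height is at least `m` times
the coincidence probability (`le_smoothedTrieHeight`).

What remains is a birthday problem. The word law has sum of squares `P ^ m`, so with `σ = √P ^ m`
all draws are distinct with probability at most `exp (-nσ/8)` once `nσ ≥ 2` (`distinctProb_le_exp`).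
For `m` about `2 (1 - ε) log_{1/P} n` the product `nσ` is at least of order `n ^ ε`, and the loss is
`o(1)`. If `P = 1`, the word law is a point mass and `m` can be arbitrarily large. -/

/-! ### Birthday bounds for non-uniform samples. -/

section Combinatorics

open Classical in
/-- The probability that independent samples, indexed by `ι`, from the weights `ρ` are pairwise
distinct. -/
noncomputable def distinctProb {B : Type*} [Fintype B] (ι : Type*) [Fintype ι] (ρ : B → ℝ) : ℝ :=
  ∑ f : ι → B, if Function.Injective f then ∏ i, ρ (f i) else 0

theorem distinctProb_congr {B ι κ : Type*} [Fintype B] [Fintype ι] [Fintype κ] (e : ι ≃ κ)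
    (ρ : B → ℝ) : distinctProb ι ρ = distinctProb κ ρ := by
  classical
  unfold distinctProb
  refine Fintype.sum_equiv (e.arrowCongr (Equiv.refl B)) _ _ fun f => ?_
  have h1 : Function.Injective ((e.arrowCongr (Equiv.refl B)) f) ↔ Function.Injective f := by
    simp [Equiv.arrowCongr]
  have h2 : ∏ i, ρ ((e.arrowCongr (Equiv.refl B)) f i) = ∏ i, ρ (f i) :=
    Fintype.prod_equiv e.symm _ _ fun i => by simp [Equiv.arrowCongr]
  simp only [h1, h2]

theorem one_sub_sum_le_prod {ι : Type*} (s : Finset ι) (x : ι → ℝ) (h0 : ∀ i, 0 ≤ x i)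
    (h1 : ∀ i, x i ≤ 1) : 1 - ∑ i ∈ s, x i ≤ ∏ i ∈ s, (1 - x i) := by
  classical
  induction s using Finset.induction_on with
  | empty => simp
  | insert a s ha ih =>
    rw [Finset.sum_insert ha, Finset.prod_insert ha]
    have hs : 0 ≤ ∑ i ∈ s, x i := Finset.sum_nonneg fun i _ => h0 i
    nlinarith [h0 a, h1 a, mul_le_mul_of_nonneg_left ih (sub_nonneg.2 (h1 a)),
      mul_nonneg (h0 a) hs]

/-- Since `(1 - y²)^k ≤ 1`, Bernoulli gives `(1 - y)^k ≤ 1 / (1 + ky)`, which is at most `1 - ky/2`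
because `ky ≤ 1`. -/
theorem one_sub_pow_le {y : ℝ} {k : ℕ} (h0 : 0 ≤ y) (h1 : k * y ≤ 1) (hy : y ≤ 1) :
    (1 - y) ^ k ≤ 1 - k * y / 2 := by
  have hk : 0 ≤ (k : ℝ) * y := by positivity
  have h2 : (1 - y) ^ k * (1 + y) ^ k ≤ 1 := by
    rw [← mul_pow]
    exact pow_le_one₀ (by nlinarith) (by nlinarith)
  have h3 : 1 + (k : ℝ) * y ≤ (1 + y) ^ k :=
    one_add_mul_le_pow (by linarith) k
  have h4 : 0 ≤ (1 - y) ^ k := pow_nonneg (by linarith) k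
  have h5 : (1 - y) ^ k * (1 + k * y) ≤ 1 := (mul_le_mul_of_nonneg_left h3 h4).trans h2
  have h6 : 1 ≤ (1 - k * y / 2) * (1 + k * y) := by nlinarith
  exact le_of_mul_le_mul_right (h5.trans h6) (by linarith)

/-- For distinctness every `κ`-sample must avoid all values of the `ι`-samples; collisions among the
`κ`-samples are ignored. Given `f`, this has probability `(1 - ∑ ρ (f i)) ^ k ≤ ∏ (1 - ρ (f i)) ^
k`, a product over `ι`, so summing over `f` yields a pure power. -/
theorem distinctProb_sum_le {B : Type*} [Fintype B] {κ ι : Type*} [Fintype κ] [Fintype ι]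
    (ρ : B → ℝ) (h0 : ∀ b, 0 ≤ ρ b) (hs : ∑ b, ρ b = 1)
    (hk : ∀ b, Fintype.card κ * ρ b ≤ 1) :
    distinctProb (ι ⊕ κ) ρ ≤
      (1 - Fintype.card κ * (∑ b, ρ b ^ 2) / 2) ^ Fintype.card ι := by
  classical
  have hle : ∀ b, ρ b ≤ 1 := fun b =>
    hs ▸ Finset.single_le_sum (fun b _ => h0 b) (Finset.mem_univ b)
  have step : ∀ f : ι → B, (∑ g : κ → B,
      if Function.Injective (Sum.elim f g) then ∏ i, ρ (Sum.elim f g i) else 0) ≤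
      ∏ i, (ρ (f i) * (1 - ρ (f i)) ^ Fintype.card κ) := by
    intro f
    by_cases hf : Function.Injective f
    · have hsub : ∑ b ∈ Finset.univ.filter (fun b => b ∉ Set.range f), ρ b =
          1 - ∑ i, ρ (f i) := by
        have h1 : ∑ i, ρ (f i) = ∑ b ∈ Finset.univ.filter (fun b => b ∈ Set.range f), ρ b := by
          rw [← Finset.sum_image (g := f) (f := ρ) fun a _ b _ h => hf h]
          congr 1
          ext b; simp
        rw [h1, ← hs, ← Finset.sum_filter_add_sum_filter_not Finset.univ (fun b => b ∈ Set.range f)]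
        ring
      calc (∑ g : κ → B,
          if Function.Injective (Sum.elim f g) then ∏ i, ρ (Sum.elim f g i) else 0)
          ≤ ∑ g : κ → B, (∏ i, ρ (f i)) *
              ∏ j, (if g j ∉ Set.range f then ρ (g j) else 0) := by
            refine Finset.sum_le_sum fun g _ => ?_
            split_ifs with h
            · rw [Fintype.prod_sum_type]
              refine le_of_eq (congrArg₂ _ rfl (Finset.prod_congr rfl fun j _ => ?_))
              rw [if_pos]
              · rfl
              · rintro ⟨i, hi⟩
                exact Sum.inl_ne_inr (h (a₁ := Sum.inl i) (a₂ := Sum.inr j) hi)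
            · refine mul_nonneg (Finset.prod_nonneg fun i _ => h0 _)
                (Finset.prod_nonneg fun j _ => ?_)
              split_ifs
              · exact le_rfl
              · exact h0 _
        _ = (∏ i, ρ (f i)) * (1 - ∑ i, ρ (f i)) ^ Fintype.card κ := by
            rw [← Finset.mul_sum, ← hsub, Finset.sum_filter, Finset.card_univ.symm,
              ← Finset.prod_const, Finset.prod_univ_sum, Fintype.piFinset_univ]
        _ ≤ (∏ i, ρ (f i)) * (∏ i, (1 - ρ (f i))) ^ Fintype.card κ := by
            refine mul_le_mul_of_nonneg_left (pow_le_pow_left₀ ?_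
              (one_sub_sum_le_prod _ _ (fun i => h0 _) fun i => hle _) _)
              (Finset.prod_nonneg fun i _ => h0 _)
            rw [← hsub]
            exact Finset.sum_nonneg fun b _ => h0 b
        _ = _ := by rw [← Finset.prod_pow, Finset.prod_mul_distrib]
    · rw [Finset.sum_eq_zero]
      · exact Finset.prod_nonneg fun i _ =>
          mul_nonneg (h0 _) (pow_nonneg (sub_nonneg.2 (hle _)) _)
      · intro g _
        rw [if_neg]
        exact fun h => hf fun a b hab => Sum.inl_injective (h (a₁ := Sum.inl a) (a₂ := Sum.inl b) hab)
  calc distinctProb (ι ⊕ κ) ρ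
      = ∑ f : ι → B, ∑ g : κ → B,
          if Function.Injective (Sum.elim f g) then ∏ i, ρ (Sum.elim f g i) else 0 := by
        unfold distinctProb
        rw [← Fintype.sum_prod_type'
          (f := fun (f : ι → B) (g : κ → B) =>
            if Function.Injective (Sum.elim f g) then ∏ i, ρ (Sum.elim f g i) else 0)]
        convert! Fintype.sum_equiv (Equiv.sumArrowEquivProdArrow ι κ B)
          (fun f => if Function.Injective f then ∏ i, ρ (f i) else 0) _ fun f => ?_
        have : Sum.elim (Equiv.sumArrowEquivProdArrow ι κ B f).1
            (Equiv.sumArrowEquivProdArrow ι κ B f).2 = f := by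
          ext x; cases x <;> rfl
        rw [this]
    _ ≤ ∑ f : ι → B, ∏ i, (ρ (f i) * (1 - ρ (f i)) ^ Fintype.card κ) :=
        Finset.sum_le_sum fun f _ => step f
    _ = (∑ b, ρ b * (1 - ρ b) ^ Fintype.card κ) ^ Fintype.card ι := by
        rw [← Finset.card_univ (α := ι), ← Finset.prod_const, Finset.prod_univ_sum,
          Fintype.piFinset_univ]
    _ ≤ _ := by
        refine pow_le_pow_left₀ (Finset.sum_nonneg fun b _ =>
          mul_nonneg (h0 _) (pow_nonneg (sub_nonneg.2 (hle _)) _)) ?_ _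
        calc _ ≤ ∑ b, ρ b * (1 - Fintype.card κ * ρ b / 2) :=
              Finset.sum_le_sum fun b _ =>
                mul_le_mul_of_nonneg_left (one_sub_pow_le (h0 b) (hk b) (hle b)) (h0 b)
          _ = _ := by
              simp only [mul_sub, mul_one, Finset.sum_sub_distrib, hs, Finset.mul_sum,
                Finset.sum_div]
              congr 1
              exact Finset.sum_congr rfl fun b _ => by ring

/-- Two of at least two independent samples from a point mass coincide with probability at least
one half. -/
theorem distinctProb_le_half {B : Type*} [Fintype B] {ι : Type*} [Fintype ι]
    (hι : 2 ≤ Fintype.card ι) (ρ : B → ℝ) (h0 : ∀ b, 0 ≤ ρ b) (hs : ∑ b, ρ b = 1)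
    (hsq : ∑ b, ρ b ^ 2 = 1) : distinctProb ι ρ ≤ 1 / 2 := by
  have hle : ∀ b, ρ b ≤ 1 := fun b =>
    hs ▸ Finset.single_le_sum (fun b _ => h0 b) (Finset.mem_univ b)
  -- A single `κ`-sample suffices: the bound becomes `(1/2) ^ (card ι - 1)`.
  have e : ι ≃ Fin (Fintype.card ι - 1) ⊕ Fin 1 :=
    Fintype.equivOfCardEq (by simp; omega)
  rw [distinctProb_congr e]
  refine (distinctProb_sum_le ρ h0 hs (by simpa using hle)).trans ?_
  simp only [Fintype.card_fin, hsq]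
  refine (pow_le_of_le_one (by norm_num) (by norm_num) (by omega)).trans ?_
  norm_num

/-- Each weight is at most `σ`, so `k = ⌊1/σ⌋` samples may be split off. Then `kσ ≥ 1/2` makes the
base at most `exp (-σ/4)`, and `nσ ≥ 2` leaves at least `n/2` samples in the exponent. -/
theorem distinctProb_le_exp {B : Type*} [Fintype B] {ι : Type*} [Fintype ι]
    (ρ : B → ℝ) (h0 : ∀ b, 0 ≤ ρ b) (hs : ∑ b, ρ b = 1) {σ : ℝ} (hσ : 0 < σ)
    (hsq : ∑ b, ρ b ^ 2 = σ ^ 2) (hn : 2 ≤ Fintype.card ι * σ) :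
    distinctProb ι ρ ≤ Real.exp (-(Fintype.card ι * σ / 8)) := by
  set n := Fintype.card ι with hn'
  have hle : ∀ b, ρ b ≤ 1 := fun b =>
    hs ▸ Finset.single_le_sum (fun b _ => h0 b) (Finset.mem_univ b)
  have hσ1 : σ ≤ 1 := by
    have : σ ^ 2 ≤ 1 := by
      rw [← hsq, ← hs]
      exact Finset.sum_le_sum fun b _ => by nlinarith [h0 b, hle b]
    nlinarith
  have hρσ : ∀ b, ρ b ≤ σ := fun b => by
    have : ρ b ^ 2 ≤ σ ^ 2 := by
      rw [← hsq]
      exact Finset.single_le_sum (f := fun b => ρ b ^ 2) (fun b _ => sq_nonneg _) (Finset.mem_univ b)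
    exact (sq_le_sq₀ (h0 b) hσ.le).1 this
  have hinv : 1 ≤ 1 / σ := by rw [le_div_iff₀ hσ]; linarith
  set k := ⌊1 / σ⌋₊ with hk
  have hk1 : (k : ℝ) ≤ 1 / σ := Nat.floor_le (by positivity)
  have hkσ : k * σ ≤ 1 := by rwa [le_div_iff₀ hσ] at hk1
  have hk2 : 1 / σ / 2 ≤ k := by
    have h1 : 1 / σ < k + 1 := Nat.lt_floor_add_one _
    have h2 : (1 : ℝ) ≤ k := by exact_mod_cast Nat.le_floor (by simpa using hinv)
    linarith
  have hkσ2 : 1 / 2 ≤ k * σ := by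
    have := mul_le_mul_of_nonneg_right hk2 hσ.le
    have h3 : 1 / σ / 2 * σ = 1 / 2 := by field_simp
    linarith
  have hkn : (k : ℝ) ≤ n / 2 := by
    refine hk1.trans ?_
    rw [div_le_iff₀ hσ]; linarith
  have hkn' : k ≤ n := by
    have : (k : ℝ) ≤ n := by have : (0 : ℝ) ≤ n := by positivity
                             linarith
    exact_mod_cast this
  have e : ι ≃ Fin (n - k) ⊕ Fin k := Fintype.equivOfCardEq (by simp; omega)
  rw [distinctProb_congr e]
  refine (distinctProb_sum_le ρ h0 hs ?_).trans ?_
  · intro b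
    simp only [Fintype.card_fin]
    exact (mul_le_mul_of_nonneg_left (hρσ b) (by positivity)).trans hkσ
  · simp only [Fintype.card_fin, hsq]
    have hb : 1 - (k : ℝ) * σ ^ 2 / 2 ≤ Real.exp (-(σ / 4)) := by
      refine le_trans ?_ (Real.one_sub_le_exp_neg _)
      nlinarith
    have hb0 : 0 ≤ 1 - (k : ℝ) * σ ^ 2 / 2 := by nlinarith
    refine (pow_le_pow_left₀ hb0 hb _).trans ?_
    rw [← Real.exp_nat_mul, Real.exp_le_exp, Nat.cast_sub hkn']
    nlinarith

open Classical in
theorem sum_not_injective_eq_one_sub_distinctProb {B : Type*} [Fintype B] {ι : Type*} [Fintype ι]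
    (ρ : B → ℝ) (hs : ∑ b, ρ b = 1) :
    ∑ f : ι → B with ¬ Function.Injective f, ∏ i, ρ (f i) = 1 - distinctProb ι ρ := by
  have h1 : ∑ f : ι → B, ∏ i, ρ (f i) = 1 := by
    rw [← Fintype.piFinset_univ, ← Finset.prod_univ_sum]
    simp [hs]
  rw [← h1, ← Finset.sum_filter_add_sum_filter_not Finset.univ
    (fun f : ι → B => Function.Injective f), distinctProb, ← Finset.sum_filter]
  simp only [add_sub_cancel_left]

end Combinatorics

/-! ### Finite-horizon events and the Markov property of the computation. -/

section Computation

instance {α R W : Type*} [Finite α] [Finite R] [Finite W] : Countable (Config α R W) :=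
  Function.Injective.countable (β := ℕ × (R ⊕ W) × Option α)
    (f := fun c => (c.pos, c.state, c.emitted)) (by
      rintro ⟨a, b, c⟩ ⟨a', b', c'⟩ h
      simpa using h)

instance {α R W : Type*} : DiscreteMeasurableSpace (Config α R W) := ⟨fun _ => trivial⟩

theorem writtenList_succ {α R W : Type*} (ω : ℕ → Config α R W) (k : ℕ) :
    writtenList ω (k + 1) = writtenList ω k ++ (ω (k + 1)).emitted.toList := by
  unfold writtenList
  rw [List.range_succ, List.filterMap_append]
  cases h : (ω (k + 1)).emitted <;> simp [h]

theorem writtenList_prefix {α R W : Type*} (ω : ℕ → Config α R W) {j k : ℕ} (h : j ≤ k) :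
    writtenList ω j <+: writtenList ω k := by
  induction k, h using Nat.le_induction with
  | base => exact List.prefix_rfl
  | succ k _ ih =>
    rw [writtenList_succ]
    exact ih.trans (List.prefix_append _ _)

theorem outputString_get? {α R W : Type*} (ω : ℕ → Config α R W) {N : ℕ} {w : List α}
    (h : w <+: writtenList ω N) {i : ℕ} (hi : i < w.length) :
    (outputString ω).get? i = some w[i] := by
  classical
  have hex : ∃ k, i < (writtenList ω k).length := ⟨N, hi.trans_le h.length_le⟩
  have h1 : (outputString ω).get? i = (writtenList ω (Nat.find hex))[i]? := by
    change (if h : ∃ k, i < (writtenList ω k).length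
      then (writtenList ω (Nat.find h))[i]? else none) = _
    rw [dif_pos hex]
  have h2 : writtenList ω (Nat.find hex) <+: writtenList ω N :=
    writtenList_prefix ω (Nat.find_min' hex (hi.trans_le h.length_le))
  rw [h1, List.getElem?_eq_getElem (Nat.find_spec hex), h2.getElem, ← h.getElem hi]

theorem le_lcp_outputString {α R W : Type*} {ω ω' : ℕ → Config α R W} {N : ℕ} {w : List α}
    (h : w <+: writtenList ω N) (h' : w <+: writtenList ω' N) :
    (w.length : ℕ∞) ≤ lcp (outputString ω) (outputString ω') := by
  refine le_iSup₂_of_le (f := fun (m : ℕ) (_ : ∀ i < m, (outputString ω).get? i =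
    (outputString ω').get? i ∧ (outputString ω).get? i ≠ none) => (m : ℕ∞)) w.length ?_ le_rfl
  intro i hi
  rw [outputString_get? ω h hi, outputString_get? ω' h' hi]
  simp

/-- Such a function factors through finitely many coordinates, a countable discrete space on which
everything is measurable. -/
theorem measurable_frestrictLe_comp {α R W : Type*} [Finite α] [Finite R] [Finite W]
    {β : Type*} [MeasurableSpace β] (k : ℕ) (f : (ℕ → Config α R W) → β)
    (hf : ∀ ω ω', (∀ i ≤ k, ω i = ω' i) → f ω = f ω') : Measurable f := by
  have h : f = (fun h : Finset.Iic k → Config α R W =>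
      f fun i => h ⟨min i k, by simp⟩) ∘ Preorder.frestrictLe k := by
    ext1 ω
    exact hf _ _ fun i hi => by simp [hi]
  rw [h]
  exact Measurable.of_discrete.comp (Preorder.measurable_frestrictLe k)

theorem writtenList_congr {α R W : Type*} {ω ω' : ℕ → Config α R W} {k : ℕ}
    (h : ∀ i ≤ k, ω i = ω' i) : writtenList ω k = writtenList ω' k := by
  unfold writtenList
  refine List.filterMap_congr fun i hi => ?_
  rw [h (i + 1) (List.mem_range.1 hi)]

theorem measurableSet_prefix_writtenList {α R W : Type*} [Finite α] [Finite R] [Finite W]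
    (w : List α) (k : ℕ) :
    MeasurableSet {ω : ℕ → Config α R W | w <+: writtenList ω k} := by
  have h : Measurable fun ω : ℕ → Config α R W => w <+: writtenList ω k :=
    measurable_frestrictLe_comp k _ fun ω ω' h => by rw [writtenList_congr h]
  exact measurableSet_setOfPred.2 h

namespace PFA

variable {α R W : Type*} [Fintype α] [Fintype R] [Fintype W]

/-- One-step Markov property: the joint law of the history up to time `k` and the next configuration
is the composition-product with the step kernel. -/
theorem lintegral_computation_succ (X : PFA α R W) (t : ℕ → α) (k : ℕ)
    (g : (ℕ → Config α R W) → Config α R W → ℝ≥0∞)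
    (hg : ∀ ω ω', (∀ i ≤ k, ω i = ω' i) → g ω = g ω') :
    ∫⁻ ω, ∫⁻ c, g ω c ∂(X.step t (ω k)).toMeasure ∂(X.computation t) =
      ∫⁻ ω, g ω (ω (k + 1)) ∂(X.computation t) := by
  let κ : (n : ℕ) → Kernel (Finset.Iic n → Config α R W) (Config α R W) := fun n =>
    (X.stepKernel t).comap (fun c => c ⟨n, Finset.mem_Iic.mpr le_rfl⟩) (measurable_pi_apply _)
  -- A finite history is extended by freezing it after time `k`, which `g` cannot detect.
  let G : (Finset.Iic k → Config α R W) × Config α R W → ℝ≥0∞ := fun p =>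
    g (fun i => p.1 ⟨min i k, by simp⟩) p.2
  have hG : Measurable G := Measurable.of_discrete
  have hGg : ∀ ω : ℕ → Config α R W, ∀ c, G (Preorder.frestrictLe k ω, c) = g ω c := by
    intro ω c
    refine congrFun (hg _ _ fun i hi => ?_) c
    simp [hi]
  have key : (X.computation t).map (Preorder.frestrictLe k) ⊗ₘ κ k =
      (X.computation t).map (fun x => (Preorder.frestrictLe k x, x (k + 1))) :=
    Kernel.map_frestrictLe_trajMeasure_compProd_eq_map_trajMeasure
      (X := fun _ => Config α R W) (κ := κ) (μ₀ := X.initMeasure)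
  have h := congrArg (fun μ => ∫⁻ p, G p ∂μ) key
  rw [Measure.lintegral_compProd hG, lintegral_map (Measurable.of_discrete)
    (Preorder.measurable_frestrictLe k), lintegral_map hG (by fun_prop)] at h
  simp only [hGg] at h
  exact h

theorem map_zero_computation (X : PFA α R W) (t : ℕ → α) :
    (X.computation t).map (fun ω => ω 0) = X.initMeasure := by
  have hm : Measurable fun h : Finset.Iic 0 → Config α R W => h ⟨0, by simp⟩ :=
    measurable_pi_apply _
  rw [computation, Kernel.trajMeasure]
  change Measure.map ((fun h : Finset.Iic 0 → Config α R W => h ⟨0, by simp⟩) ∘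
    Preorder.frestrictLe (π := fun _ => Config α R W) 0) _ = _
  rw [← Measure.map_map hm (Preorder.measurable_frestrictLe 0),
    Measure.map_comp _ _ (Preorder.measurable_frestrictLe 0),
    Kernel.traj_map_frestrictLe, Kernel.partialTraj_self, Measure.id_comp,
    Measure.map_map hm (by fun_prop)]
  exact Measure.map_id

/-- The probability that `w` is a prefix of what has been written `n` steps later, if `v` is what
has been written when the configuration `c` is reached. -/
noncomputable def prefixProb (X : PFA α R W) (t : ℕ → α) (w : List α) :
    ℕ → List α → Config α R W → ℝ≥0∞
  | 0, v, _ => Set.indicator {v | w <+: v} 1 v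
  | n + 1, v, c => ∫⁻ c', prefixProb X t w n (v ++ c'.emitted.toList) c' ∂(X.step t c).toMeasure

/-- The Markov property trades one remaining step for one elapsed step; at `k = 0` this turns a path
probability into a recursion over the steps. -/
theorem lintegral_prefixProb (X : PFA α R W) (t : ℕ → α) (w : List α) (n : ℕ) : ∀ k : ℕ,
    ∫⁻ ω, X.prefixProb t w n (writtenList ω k) (ω k) ∂(X.computation t) =
      X.computation t {ω | w <+: writtenList ω (k + n)} := by
  induction n with
  | zero =>
    intro k
    rw [← lintegral_indicator_one (measurableSet_prefix_writtenList w _)]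
    rfl
  | succ n ih =>
    intro k
    simp only [prefixProb]
    rw [X.lintegral_computation_succ t k
      (fun ω c' => X.prefixProb t w n (writtenList ω k ++ c'.emitted.toList) c')
      (fun ω ω' h => by rw [writtenList_congr h])]
    simp only [← writtenList_succ]
    rw [ih (k + 1)]
    congr 3
    ext; congr! 2
    omega

theorem computation_prefix_writtenList (X : PFA α R W) (t : ℕ → α) (w : List α) (n : ℕ) :
    X.computation t {ω | w <+: writtenList ω n} =
      ∫⁻ c, X.prefixProb t w n [] c ∂X.initMeasure := by
  rw [← X.map_zero_computation t, lintegral_map Measurable.of_discrete (measurable_pi_apply 0)]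
  have := X.lintegral_prefixProb t w n 0
  rw [zero_add] at this
  rw [← this]
  rfl

end PFA

end Computation

/-! ### Lower bounds for the probability of writing a given word. -/

section PrefixBound

theorem pmfOfReal_apply {ι : Type*} [Fintype ι] (f : ι → ℝ) (h0 : ∀ i, 0 ≤ f i)
    (h1 : ∑ i, f i = 1) (i : ι) : pmfOfReal f h0 h1 i = ENNReal.ofReal (f i) := rfl

theorem PMF.lintegral_map_toMeasure {ι γ : Type*} [Fintype ι] [MeasurableSpace γ]
    [DiscreteMeasurableSpace γ] (p : PMF ι) (f : ι → γ) (g : γ → ℝ≥0∞) :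
    ∫⁻ c, g c ∂(p.map f).toMeasure = ∑ i, g (f i) * p i := by
  let _ : MeasurableSpace ι := ⊤
  rw [← PMF.toMeasure_map f p measurable_from_top,
    lintegral_map Measurable.of_discrete measurable_from_top, lintegral_fintype]
  exact Finset.sum_congr rfl fun i _ => by
    rw [PMF.toMeasure_apply_singleton _ _ (MeasurableSet.singleton i)]

namespace PFA

variable {α R W : Type*} [Fintype α] [Fintype R] [Fintype W]

theorem prefixProb_eq_one (X : PFA α R W) (t : ℕ → α) (w : List α) (n : ℕ) :
    ∀ (v : List α) (c : Config α R W), w <+: v → X.prefixProb t w n v c = 1 := by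
  induction n with
  | zero =>
    intro v c h
    simp [prefixProb, h]
  | succ n ih =>
    intro v c h
    simp only [prefixProb]
    rw [lintegral_congr fun c' => ih _ c' (h.trans (List.prefix_append _ _))]
    simp

theorem prefixProb_read (X : PFA α R W) (t : ℕ → α) (w : List α) (n : ℕ) (v : List α)
    (j : ℕ) (r : R) (e : Option α) :
    X.prefixProb t w (n + 1) v ⟨j, Sum.inl r, e⟩ =
      ∑ p, X.prefixProb t w n v ⟨j + 1, p, none⟩ * ENNReal.ofReal (X.readProb r (t j) p) := by
  simp only [prefixProb, step]
  rw [PMF.lintegral_map_toMeasure]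
  simp [readPMF, pmfOfReal_apply]

theorem prefixProb_write (X : PFA α R W) (t : ℕ → α) (w : List α) (n : ℕ) (v : List α)
    (j : ℕ) (q : W) (e : Option α) :
    X.prefixProb t w (n + 1) v ⟨j, Sum.inr q, e⟩ =
      ∑ b, ∑ p, X.prefixProb t w n (v ++ [b]) ⟨j, p, some b⟩ *
        ENNReal.ofReal (X.writeProb q b p) := by
  simp only [prefixProb, step]
  rw [PMF.lintegral_map_toMeasure, Fintype.sum_prod_type]
  simp [writePMF, pmfOfReal_apply]

theorem le_prefixProb_read (X : PFA α R W) (t : ℕ → α) (w : List α) (n : ℕ) (v : List α)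
    (j : ℕ) (s : R) (q : W) (e : Option α) :
    X.prefixProb t w n v ⟨j + 1, Sum.inl s, none⟩ *
        ENNReal.ofReal (X.readProb s (t j) (Sum.inl s)) +
      X.prefixProb t w n v ⟨j + 1, Sum.inr q, none⟩ *
        ENNReal.ofReal (X.readProb s (t j) (Sum.inr q)) ≤
    X.prefixProb t w (n + 1) v ⟨j, Sum.inl s, e⟩ := by
  rw [prefixProb_read, Fintype.sum_sum_type]
  exact add_le_add
    (Finset.single_le_sum (f := fun r => X.prefixProb t w n v ⟨j + 1, Sum.inl r, none⟩ *
      ENNReal.ofReal (X.readProb s (t j) (Sum.inl r))) (fun _ _ => zero_le) (Finset.mem_univ s))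
    (Finset.single_le_sum (f := fun r => X.prefixProb t w n v ⟨j + 1, Sum.inr r, none⟩ *
      ENNReal.ofReal (X.readProb s (t j) (Sum.inr r))) (fun _ _ => zero_le) (Finset.mem_univ q))

theorem le_prefixProb_write (X : PFA α R W) (t : ℕ → α) (w : List α) (n : ℕ) (v : List α)
    (j : ℕ) (s : R) (q : W) (b : α) (e : Option α) :
    X.prefixProb t w n (v ++ [b]) ⟨j, Sum.inl s, some b⟩ *
        ENNReal.ofReal (X.writeProb q b (Sum.inl s)) +
      X.prefixProb t w n (v ++ [b]) ⟨j, Sum.inr q, some b⟩ *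
        ENNReal.ofReal (X.writeProb q b (Sum.inr q)) ≤
    X.prefixProb t w (n + 1) v ⟨j, Sum.inr q, e⟩ := by
  rw [prefixProb_write]
  refine le_trans ?_ (Finset.single_le_sum (f := fun b => ∑ p,
    X.prefixProb t w n (v ++ [b]) ⟨j, p, some b⟩ * ENNReal.ofReal (X.writeProb q b p))
    (fun _ _ => zero_le) (Finset.mem_univ b))
  rw [Fintype.sum_sum_type]
  exact add_le_add
    (Finset.single_le_sum (f := fun r => X.prefixProb t w n (v ++ [b]) ⟨j, Sum.inl r, some b⟩ *
      ENNReal.ofReal (X.writeProb q b (Sum.inl r))) (fun _ _ => zero_le) (Finset.mem_univ s))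
    (Finset.single_le_sum (f := fun r => X.prefixProb t w n (v ++ [b]) ⟨j, Sum.inr r, some b⟩ *
      ENNReal.ofReal (X.writeProb q b (Sum.inr r))) (fun _ _ => zero_le) (Finset.mem_univ q))

/-- The probability that an output state `q`, alternating with the input state `s`, writes `b`. -/
def letterProb (X : PFA α R W) (s : R) (q : W) (b : α) : ℝ :=
  X.writeProb q b (Sum.inr q) + X.writeProb q b (Sum.inl s)

theorem letterProb_nonneg (X : PFA α R W) (s : R) (q : W) (b : α) : 0 ≤ X.letterProb s q b :=
  add_nonneg (X.writeProb_nonneg _ _ _) (X.writeProb_nonneg _ _ _)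

/-- In a star-like automaton a writing step from `q` can lead only to `q` or `s`, so no mass is
missing. -/
theorem IsStarLike.sum_letterProb {X : PFA α R W} {s : R} (hX : X.IsStarLike s) (q : W) :
    ∑ b, X.letterProb s q b = 1 := by
  rw [← X.writeProb_sum q]
  refine Finset.sum_congr rfl fun b _ => ?_
  rw [Fintype.sum_sum_type, letterProb, add_comm]
  congr 1
  · rw [Fintype.sum_eq_single s fun r hr => absurd (hX.unique_input r) hr]
  · rw [Fintype.sum_eq_single q fun r hr => hX.no_move q r hr.symm b]

/-- On a long run of the symbol `a`, each written symbol is produced within `K` reading steps with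
probability at least `1 - p ^ K`, independently of the past. -/
theorem le_prefixProb (X : PFA α R W) {s : R} {q : W} {a : α}
    (hq : X.readProb s a (Sum.inr q) = 1 - X.readProb s a (Sum.inl s))
    {t : ℕ → α} {L : ℕ} (ht : ∀ i < L, t i = a) (K : ℕ) (w : List α) (u : List α) :
    ∀ (v : List α), w = v ++ u → ∀ (n j : ℕ) (e : Option α), j + K * u.length ≤ L →
      (K + 1) * u.length ≤ n →
      ENNReal.ofReal ((u.map fun b =>
          (1 - X.readProb s a (Sum.inl s) ^ K) * X.letterProb s q b).prod) ≤
        X.prefixProb t w n v ⟨j, Sum.inl s, e⟩ ∧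
      ENNReal.ofReal ((u.map fun b =>
          (1 - X.readProb s a (Sum.inl s) ^ K) * X.letterProb s q b).prod) ≤
        X.prefixProb t w n v ⟨j, Sum.inr q, e⟩ := by
  have hp0 : 0 ≤ X.readProb s a (Sum.inl s) := X.readProb_nonneg _ _ _
  have hp1 : X.readProb s a (Sum.inl s) ≤ 1 := by
    have := X.readProb_nonneg s a (Sum.inr q)
    linarith
  set p := X.readProb s a (Sum.inl s) with hp
  have hη : 0 ≤ 1 - p ^ K := sub_nonneg.2 (pow_le_one₀ hp0 hp1)
  have hprod : ∀ l : List α, 0 ≤ (l.map fun b => (1 - p ^ K) * X.letterProb s q b).prod := by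
    intro l
    refine List.prod_nonneg fun x hx => ?_
    obtain ⟨b, _, rfl⟩ := List.mem_map.1 hx
    exact mul_nonneg hη (X.letterProb_nonneg s q b)
  induction u with
  | nil =>
    intro v hv n j e _ _
    have hv' : w <+: v := by rw [hv, List.append_nil]
    simp [X.prefixProb_eq_one t w n v _ hv']
  | cons b u ih =>
    intro v hv n j e hj hn
    simp only [List.length_cons, List.map_cons, List.prod_cons] at hj hn ⊢
    set C := (u.map fun b => (1 - p ^ K) * X.letterProb s q b).prod with hC
    have hC0 : 0 ≤ C := hprod u
    have hv' : w = (v ++ [b]) ++ u := by rw [hv]; simp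
    -- After writing `b` the state is `s` or `q`. The induction bound `C` holds at both, so the two
    -- transition weights add up to `letterProb`; this is why both states are treated together.
    have hwrite : ∀ (n j : ℕ) (e : Option α), j + K * u.length ≤ L →
        (K + 1) * u.length + 1 ≤ n →
        ENNReal.ofReal (X.letterProb s q b * C) ≤ X.prefixProb t w n v ⟨j, Sum.inr q, e⟩ := by
      intro n j e hj hn
      obtain ⟨n, rfl⟩ : ∃ n', n = n' + 1 := ⟨n - 1, by omega⟩
      refine le_trans ?_ (X.le_prefixProb_write t w n v j s q b e)
      obtain ⟨h1, h2⟩ := ih (v ++ [b]) hv' n j (some b) hj (by omega)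
      refine le_trans ?_ (add_le_add (mul_le_mul_left h1 _) (mul_le_mul_left h2 _))
      rw [← ENNReal.ofReal_mul hC0, ← ENNReal.ofReal_mul hC0, ← ENNReal.ofReal_add
        (mul_nonneg hC0 (X.writeProb_nonneg _ _ _)) (mul_nonneg hC0 (X.writeProb_nonneg _ _ _))]
      refine ENNReal.ofReal_le_ofReal (le_of_eq ?_)
      rw [letterProb]; ring
    -- Allow `k` readings for leaving `s`: either the loop is taken and `k - 1` remain, or `q` is
    -- entered, and `p (1 - p ^ (k - 1)) + (1 - p) = 1 - p ^ k`.
    have hread : ∀ (k n j : ℕ) (e : Option α), j + k + K * u.length ≤ L →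
        (K + 1) * u.length + 1 + k ≤ n →
        ENNReal.ofReal ((1 - p ^ k) * (X.letterProb s q b * C)) ≤
          X.prefixProb t w n v ⟨j, Sum.inl s, e⟩ := by
      have hD : 0 ≤ X.letterProb s q b * C := mul_nonneg (X.letterProb_nonneg s q b) hC0
      intro k
      induction k with
      | zero => intro n j e _ _; simp
      | succ k ihk =>
        intro n j e hj hn
        obtain ⟨n, rfl⟩ : ∃ n', n = n' + 1 := ⟨n - 1, by omega⟩
        refine le_trans ?_ (X.le_prefixProb_read t w n v j s q e)
        have h1 := ihk n (j + 1) none (by omega) (by omega)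
        have h2 := hwrite n (j + 1) none (by omega) (by omega)
        refine le_trans ?_ (add_le_add (mul_le_mul_left h1 _) (mul_le_mul_left h2 _))
        have hk : 0 ≤ 1 - p ^ k := sub_nonneg.2 (pow_le_one₀ hp0 hp1)
        rw [ht j (by omega), hq, ← hp, ← ENNReal.ofReal_mul (mul_nonneg hk hD),
          ← ENNReal.ofReal_mul hD, ← ENNReal.ofReal_add
            (mul_nonneg (mul_nonneg hk hD) hp0) (mul_nonneg hD (by linarith))]
        refine ENNReal.ofReal_le_ofReal (le_of_eq ?_)
        ring
    constructor
    · have := hread K n j e (by linarith) (by linarith)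
      rwa [mul_assoc]
    -- From `q` no reading is needed, so the factor `1 - p ^ K` is simply given away.
    · refine le_trans (ENNReal.ofReal_le_ofReal ?_) (hwrite n j e (by nlinarith) (by nlinarith))
      rw [mul_assoc]
      refine mul_le_of_le_one_left (mul_nonneg (X.letterProb_nonneg s q b) hC0) ?_
      have := pow_nonneg hp0 K
      linarith

theorem IsCanonical.lintegral_initMeasure {X : PFA α R W} {s : R} (hX : X.IsStarLike s)
    (hcan : X.IsCanonical s) (g : Config α R W → ℝ≥0∞) :
    ∫⁻ c, g c ∂X.initMeasure = g ⟨0, Sum.inl s, none⟩ := by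
  rw [initMeasure, PMF.lintegral_map_toMeasure, Fintype.sum_sum_type,
    Fintype.sum_eq_single s fun r hr => absurd (hX.unique_input r) hr]
  simp [initPMF, pmfOfReal_apply, hcan.1, hcan.2]

/-- For every word `w`, the output on an input with a long prefix `a … a` starts with `w` with
probability at least nearly the product of the letter probabilities. -/
theorem le_computation_prefix (X : PFA α R W) {s : R} (hX : X.IsStarLike s)
    (hcan : X.IsCanonical s) {q : W} {a : α}
    (hq : X.readProb s a (Sum.inr q) = 1 - X.readProb s a (Sum.inl s))
    (K : ℕ) {t : ℕ → α} (w : List α) (ht : ∀ i < K * w.length, t i = a) :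
    ENNReal.ofReal ((1 - X.readProb s a (Sum.inl s) ^ K) ^ w.length *
        (w.map (X.letterProb s q)).prod) ≤
      X.computation t {ω | w <+: writtenList ω ((K + 1) * w.length)} := by
  rw [computation_prefix_writtenList, hcan.lintegral_initMeasure hX]
  refine le_trans (le_of_eq ?_) (X.le_prefixProb hq ht K w w [] rfl _ 0 none (by simp) le_rfl).1
  congr 1
  rw [List.prod_map_mul]
  simp

end PFA

end PrefixBound

/-! ### From coinciding words to the trie height. -/

section Height

/-- There are arbitrarily many infinite strings with a given prefix `a … a`. -/
theorem exists_finset_long_run {α : Type*} [Nontrivial α] (a : α) (L n : ℕ) :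
    ∃ A : Finset (ℕ → α), A.card = n ∧ ∀ t ∈ A, ∀ i < L, t i = a := by
  classical
  obtain ⟨b, hb⟩ := exists_ne a
  have hinj : Function.Injective fun (k : ℕ) (i : ℕ) => if i = L + k then b else a := by
    intro k k' h
    have h1 := congrFun h (L + k)
    by_contra hk
    simp [hk, hb] at h1
  refine ⟨(Finset.range n).map ⟨_, hinj⟩, by simp, ?_⟩
  intro t ht i hi
  obtain ⟨k, _, rfl⟩ := Finset.mem_map.1 ht
  simp only [Function.Embedding.coeFn_mk]
  rw [if_neg (by omega)]

namespace PFA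

variable {α R W : Type*} [Fintype α] [Fintype R] [Fintype W]

/-- The probability that the first symbols written, all from the output state `q`, form `w`. -/
def wordProb (X : PFA α R W) (s : R) (q : W) {m : ℕ} (w : Fin m → α) : ℝ :=
  ∏ i, X.letterProb s q (w i)

theorem wordProb_nonneg (X : PFA α R W) (s : R) (q : W) {m : ℕ} (w : Fin m → α) :
    0 ≤ X.wordProb s q w :=
  Finset.prod_nonneg fun _ _ => X.letterProb_nonneg s q _

theorem IsStarLike.sum_wordProb {X : PFA α R W} {s : R} (hX : X.IsStarLike s) (q : W) (m : ℕ) :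
    ∑ w : Fin m → α, X.wordProb s q w = 1 := by
  classical
  simp only [wordProb]
  rw [← Fintype.piFinset_univ, ← Finset.prod_univ_sum]
  simp [hX.sum_letterProb q]

theorem sum_wordProb_sq (X : PFA α R W) (s : R) (q : W) (m : ℕ) :
    ∑ w : Fin m → α, X.wordProb s q w ^ 2 = (∑ b, X.letterProb s q b ^ 2) ^ m := by
  classical
  simp only [wordProb, ← Finset.prod_pow]
  rw [← Fintype.piFinset_univ,
    ← Finset.prod_univ_sum (fun _ => Finset.univ) (fun _ b => X.letterProb s q b ^ 2)]
  simp

/-- Two of the strings `X(t)`, `t ∈ A`, have a common prefix of length `m` with at least nearly the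
probability that independent words of length `m` are not distinct. -/
theorem exists_le_measure_pi_collision (X : PFA α R W) {s : R} (hX : X.IsStarLike s)
    (hcan : X.IsCanonical s) {q : W} {a : α}
    (hq : X.readProb s a (Sum.inr q) = 1 - X.readProb s a (Sum.inl s)) (K m : ℕ)
    (A : Finset (ℕ → α)) (hA : ∀ t ∈ A, ∀ i < K * m, t i = a) :
    ∃ S : Set (A → ℕ → Config α R W), MeasurableSet S ∧
      (∀ ω ∈ S, ∃ u v : A, u ≠ v ∧
        (m : ℕ∞) ≤ lcp (outputString (ω u)) (outputString (ω v))) ∧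
      ENNReal.ofReal (((1 - X.readProb s a (Sum.inl s) ^ K) ^ m) ^ A.card *
        (1 - distinctProb A (X.wordProb s q (m := m)))) ≤
      (Measure.pi fun u : A => X.computation u.1) S := by
  classical
  have hp0 : 0 ≤ X.readProb s a (Sum.inl s) := X.readProb_nonneg _ _ _
  have hp1 : X.readProb s a (Sum.inl s) ≤ 1 := by
    have := X.readProb_nonneg s a (Sum.inr q)
    linarith
  set η := (1 - X.readProb s a (Sum.inl s) ^ K) ^ m with hη
  have hη0 : 0 ≤ η := pow_nonneg (sub_nonneg.2 (pow_le_one₀ hp0 hp1)) m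
  -- The time horizon grants each letter `K` readings and one writing step.
  let E : (A → Fin m → α) → Set (A → ℕ → Config α R W) := fun f =>
    Set.univ.pi fun u => {ω | List.ofFn (f u) <+: writtenList ω ((K + 1) * m)}
  let F := Finset.univ.filter fun f : A → Fin m → α => ¬ Function.Injective f
  have hE : ∀ f, MeasurableSet (E f) := fun f =>
    MeasurableSet.univ_pi fun u => measurableSet_prefix_writtenList _ _
  refine ⟨⋃ f ∈ F, E f, Finset.measurableSet_biUnion F fun f _ => hE f, ?_, ?_⟩
  · intro ω hω
    obtain ⟨f, hf, hω⟩ := Set.mem_iUnion₂.1 hω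
    have hf' : ¬ Function.Injective f := (Finset.mem_filter.1 hf).2
    rw [Function.not_injective_iff] at hf'
    obtain ⟨u, v, huv, hne⟩ := hf'
    have h1 : List.ofFn (f u) <+: writtenList (ω u) ((K + 1) * m) := hω u trivial
    have h2 : List.ofFn (f v) <+: writtenList (ω v) ((K + 1) * m) := hω v trivial
    refine ⟨u, v, hne, ?_⟩
    simpa using le_lcp_outputString h1 (huv ▸ h2)
  · calc ENNReal.ofReal (η ^ A.card * (1 - distinctProb A (X.wordProb s q (m := m))))
        = ∑ f ∈ F, ∏ u, ENNReal.ofReal (η * X.wordProb s q (f u)) := by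
          rw [← sum_not_injective_eq_one_sub_distinctProb _ (hX.sum_wordProb q m), Finset.mul_sum,
            ENNReal.ofReal_sum_of_nonneg]
          · refine Finset.sum_congr (by ext; simp [F]) fun f _ => ?_
            rw [← ENNReal.ofReal_prod_of_nonneg
              fun u _ => mul_nonneg hη0 (X.wordProb_nonneg s q _), Finset.prod_mul_distrib]
            simp
          · exact fun f _ => mul_nonneg (pow_nonneg hη0 _)
              (Finset.prod_nonneg fun u _ => X.wordProb_nonneg s q _)
      _ ≤ ∑ f ∈ F, (Measure.pi fun u : A => X.computation u.1) (E f) := by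
          refine Finset.sum_le_sum fun f _ => ?_
          rw [Measure.pi_pi]
          refine Finset.prod_le_prod' fun u _ => ?_
          have h := X.le_computation_prefix hX hcan hq K (t := u.1) (List.ofFn (f u))
            (by simpa using hA u.1 u.2)
          simpa [wordProb, List.map_ofFn, List.prod_ofFn] using h
      _ = (Measure.pi fun u : A => X.computation u.1) (⋃ f ∈ F, E f) := by
          -- The events are disjoint, since a written list has at most one prefix of length `m`.
          refine (measure_biUnion_finset ?_ fun f _ => hE f).symm
          intro f _ g _ hfg
          refine Set.disjoint_left.2 fun ω hf hg => hfg ?_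
          funext u
          have h1 : List.ofFn (f u) <+: writtenList (ω u) ((K + 1) * m) := hf u trivial
          have h2 : List.ofFn (g u) <+: writtenList (ω u) ((K + 1) * m) := hg u trivial
          exact List.ofFn_injective
            ((List.prefix_of_prefix_length_le h1 h2 (by simp)).eq_of_length (by simp))

/-- If `a` is not always deleted, the smoothed trie height is at least `m` times the probability
that `n` independent words of length `m`, written from the state `q_a`, are not distinct. -/
theorem le_smoothedTrieHeight [Nontrivial α] (X : PFA α R W) {s : R} (hX : X.IsStarLike s)
    (hcan : X.IsCanonical s) {q : W} {a : α}
    (hq : X.readProb s a (Sum.inr q) = 1 - X.readProb s a (Sum.inl s))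
    (ha : X.readProb s a (Sum.inl s) < 1) (n m : ℕ) :
    ENNReal.ofReal (m * (1 - distinctProb (Fin n) (X.wordProb s q (m := m)))) ≤
      X.smoothedTrieHeight Set.univ n := by
  set D := 1 - distinctProb (Fin n) (X.wordProb s q (m := m)) with hD
  have hp0 : 0 ≤ X.readProb s a (Sum.inl s) := X.readProb_nonneg _ _ _
  set p := X.readProb s a (Sum.inl s) with hp
  -- The input set depends on `K`, but the right-hand side does not, so `K` may tend to infinity
  -- afterwards.
  have hbound : ∀ K : ℕ, ENNReal.ofReal (m * (((1 - p ^ K) ^ m) ^ n * D)) ≤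
      X.smoothedTrieHeight Set.univ n := by
    intro K
    obtain ⟨A, hcard, hA⟩ := exists_finset_long_run a (K * m) n
    refine le_trans ?_ (le_iSup₂_of_le A (Set.subset_univ _) (le_iSup_of_le hcard le_rfl))
    obtain ⟨S, hS, hlcp, hle⟩ := X.exists_le_measure_pi_collision hX hcan hq K m A hA
    rw [distinctProb_congr (Fintype.equivOfCardEq (by simp [hcard]) : A ≃ Fin n), hcard] at hle
    rw [ENNReal.ofReal_mul (by positivity), ENNReal.ofReal_natCast]
    refine (mul_le_mul_right hle _).trans ?_
    rw [← lintegral_indicator_const hS]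
    refine lintegral_mono fun ω => ?_
    by_cases hω : ω ∈ S
    · obtain ⟨u, v, huv, h⟩ := hlcp ω hω
      rw [Set.indicator_of_mem hω]
      refine le_iSup_of_le u (le_iSup_of_le v (le_iSup_of_le huv ?_))
      simpa using ENat.toENNReal_le.2 h
    · rw [Set.indicator_of_notMem hω]
      exact zero_le
  have h1 : Filter.Tendsto (fun K : ℕ => p ^ K) Filter.atTop (nhds 0) :=
    tendsto_pow_atTop_nhds_zero_of_lt_one hp0 ha
  have h2 : Filter.Tendsto (fun K : ℕ => m * (((1 - p ^ K) ^ m) ^ n * D)) Filter.atTop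
      (nhds (m * D)) := by
    simpa using (((((tendsto_const_nhds (x := (1 : ℝ))).sub h1).pow m).pow n).mul_const D).const_mul
      (m : ℝ)
  exact le_of_tendsto' (ENNReal.tendsto_ofReal h2) hbound

end PFA

end Height

/-! ### Choice of the word length and size of the error. -/

section Asymptotics

open Filter Topology

/-- By `log n ≤ n ^ ε / ε`, the claim reduces to the decay of `z exp (-bz)` at `z = n ^ ε`. -/
theorem tendsto_log_mul_exp_neg_rpow {ε b : ℝ} (hε : 0 < ε) (hb : 0 < b) (C : ℝ) (hC : 0 ≤ C) :
    Tendsto (fun n : ℕ => C * Real.log n * Real.exp (-b * (n : ℝ) ^ ε)) atTop (𝓝 0) := by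
  have hz : Tendsto (fun n : ℕ => (n : ℝ) ^ ε) atTop atTop :=
    (tendsto_rpow_atTop hε).comp tendsto_natCast_atTop_atTop
  have h1 : Tendsto (fun n : ℕ => C / ε * (((n : ℝ) ^ ε) ^ (1 : ℝ) * Real.exp (-b * (n : ℝ) ^ ε)))
      atTop (𝓝 0) := by
    simpa using ((tendsto_rpow_mul_exp_neg_mul_atTop_nhds_zero 1 b hb).comp hz).const_mul (C / ε)
  refine squeeze_zero (fun n => ?_) (fun n => ?_) h1
  · exact mul_nonneg (mul_nonneg hC (Real.log_natCast_nonneg n)) (Real.exp_nonneg _)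
  · rw [Real.rpow_one, ← mul_assoc, div_mul_eq_mul_div, mul_div_assoc]
    exact mul_le_mul_of_nonneg_right (mul_le_mul_of_nonneg_left
      (Real.log_le_rpow_div (Nat.cast_nonneg n) hε) hC) (Real.exp_nonneg _)

/-- The scale of the collision probability of words of length slightly above
`2 (1 - ε) log_{1/P} n`. -/
theorem le_mul_sqrt_pow {P ε : ℝ} (hP0 : 0 < P) (hP1 : P < 1) {n : ℕ} (hn : 1 ≤ n) {m : ℕ}
    (hm : (m : ℝ) ≤ 2 * (1 - ε) * Real.logb (1 / P) n + 1) :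
    √P * (n : ℝ) ^ ε ≤ n * √P ^ m := by
  have hn0 : (0 : ℝ) < n := by exact_mod_cast hn
  have hlog : Real.log P < 0 := Real.log_neg hP0 hP1
  have hs : √P = Real.exp (Real.log P / 2) := by
    rw [← Real.log_sqrt hP0.le, Real.exp_log (Real.sqrt_pos.2 hP0)]
  have hx : Real.logb (1 / P) n * Real.log P = -Real.log n := by
    rw [Real.logb, one_div, Real.log_inv, div_neg, neg_mul, div_mul_cancel₀ _ hlog.ne]
  rw [hs, Real.rpow_def_of_pos hn0, ← Real.exp_nat_mul, ← Real.exp_add]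
  nth_rw 2 [← Real.exp_log hn0]
  rw [← Real.exp_add, Real.exp_le_exp]
  -- In logarithms the bound is linear in `m`; the `+ 1` from rounding up costs exactly the factor
  -- `√P`.
  have h2 := mul_le_mul_of_nonpos_right hm hlog.le
  have h3 : (2 * (1 - ε) * Real.logb (1 / P) n + 1) * Real.log P =
      -(2 * (1 - ε) * Real.log n) + Real.log P := by
    linear_combination (2 * (1 - ε)) * hx
  linarith

end Asymptotics

/-! ### An optimal letter that is not always deleted, and the conclusion. -/

namespace PFA

variable {α R W : Type*} [Fintype α] [Fintype R] [Fintype W]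

/-- The maximising letter might always be deleted. Then every output state satisfies the equation
defining its target, so uniqueness leaves only one output state, and any letter that is not always
deleted has the same target. -/
theorem IsReadSemiDeterministic.exists_coincidence_eq [Nontrivial α] {X : PFA α R W} {s : R}
    (hX : X.IsReadSemiDeterministic s) (hdel : ∃ a : α, X.readProb s a (Sum.inl s) < 1) :
    ∃ (a : α) (q : W), X.readProb s a (Sum.inr q) = 1 - X.readProb s a (Sum.inl s) ∧
      X.readProb s a (Sum.inl s) < 1 ∧ ∑ b, X.letterProb s q b ^ 2 = coincidence hX := by
  have hspec : ∀ a, X.readProb s a (Sum.inr (target hX a)) = 1 - X.readProb s a (Sum.inl s) :=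
    fun a => (hX.existsUnique_target a).choose_spec.1
  obtain ⟨a, _, ha⟩ := Finset.exists_mem_eq_sup' Finset.univ_nonempty fun a : α =>
    ∑ b, (X.writeProb (target hX a) b (Sum.inr (target hX a))
      + X.writeProb (target hX a) b (Sum.inl s)) ^ 2
  by_cases h1 : X.readProb s a (Sum.inl s) < 1
  · exact ⟨a, target hX a, hspec a, h1, ha.symm⟩
  · obtain ⟨a', ha'⟩ := hdel
    have hle : ∀ q, X.readProb s a (Sum.inl s) + X.readProb s a (Sum.inr q) ≤ 1 := by
      intro q
      rw [← X.readProb_sum s a, Fintype.sum_sum_type]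
      exact add_le_add
        (Finset.single_le_sum (f := fun r => X.readProb s a (Sum.inl r))
          (fun _ _ => X.readProb_nonneg _ _ _) (Finset.mem_univ s))
        (Finset.single_le_sum (f := fun r => X.readProb s a (Sum.inr r))
          (fun _ _ => X.readProb_nonneg _ _ _) (Finset.mem_univ q))
    have heq : ∀ q, X.readProb s a (Sum.inr q) = 1 - X.readProb s a (Sum.inl s) := by
      intro q
      have h2 := hle q
      have h3 := X.readProb_nonneg s a (Sum.inr q)
      linarith [hle (target hX a), hspec a]
    refine ⟨a', target hX a, ?_, ha', ha.symm⟩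
    rw [(hX.existsUnique_target a).unique (heq (target hX a)) (heq (target hX a'))]
    exact hspec a'

theorem IsStarLike.sum_letterProb_sq_pos {X : PFA α R W} {s : R} (hX : X.IsStarLike s) (q : W) :
    0 < ∑ b, X.letterProb s q b ^ 2 := by
  refine lt_of_le_of_ne (Finset.sum_nonneg fun b _ => sq_nonneg _) fun h => ?_
  have h0 : ∀ b, X.letterProb s q b = 0 := fun b =>
    pow_eq_zero_iff (two_ne_zero) |>.1 ((Finset.sum_eq_zero_iff_of_nonneg
      fun b _ => sq_nonneg _).1 h.symm b (Finset.mem_univ b))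
  simpa [h0] using hX.sum_letterProb q

end PFA

theorem proposition1 {α R W : Type*} [Fintype α] [Nontrivial α] [Fintype R] [Fintype W]
    (X : PFA α R W) (s : R) (hX : X.IsReadSemiDeterministic s) (hcan : X.IsCanonical s)
    (hdel : ∃ a : α, X.readProb s a (Sum.inl s) < 1) :
    (PFA.coincidence hX < 1 → ∀ ε : ℝ, 0 < ε →
      ∃ e : ℕ → ℝ, Filter.Tendsto e Filter.atTop (nhds 0) ∧ ∀ n : ℕ, 1 ≤ n →
        ((2 * (1 - ε) * Real.logb (1 / PFA.coincidence hX) n - e n : ℝ) : EReal) ≤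
          (X.smoothedTrieHeight Set.univ n : EReal)) ∧
    (PFA.coincidence hX = 1 → ∀ n : ℕ, 2 ≤ n → X.smoothedTrieHeight Set.univ n = ⊤) := by
  obtain ⟨a, q, hq, ha, hP⟩ := hX.exists_coincidence_eq hdel
  have hstar := hX.toIsStarLike
  have hP0 := hstar.sum_letterProb_sq_pos q
  have hH := X.le_smoothedTrieHeight hstar hcan hq ha
  set P := PFA.coincidence hX
  rw [hP] at hP0
  constructor
  · intro hP1 ε hε
    have hbase : 1 < 1 / P := by rwa [lt_div_iff₀ hP0, one_mul]
    have hlogb : ∀ n : ℕ, 1 ≤ n → 0 ≤ Real.logb (1 / P) n := fun n hn =>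
      Real.logb_nonneg hbase (by exact_mod_cast hn)
    -- For `ε ≥ 1` the main term is nonpositive and no error is needed.
    rcases le_or_gt 1 ε with hε1 | hε1
    · refine ⟨fun _ => 0, tendsto_const_nhds, fun n hn => ?_⟩
      have h : 2 * (1 - ε) * Real.logb (1 / P) n - 0 ≤ 0 := by
        nlinarith [mul_nonneg (sub_nonneg.2 hε1) (hlogb n hn)]
      exact (EReal.coe_le_coe_iff.2 h).trans (EReal.coe_ennreal_nonneg _)
    · let x : ℕ → ℝ := fun n => 2 * (1 - ε) * Real.logb (1 / P) n
      let y : ℕ → ℝ := fun n => √P * (n : ℝ) ^ ε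
      have hsP : 0 < √P := Real.sqrt_pos.2 hP0
      have hy : ∀ᶠ n in Filter.atTop, 2 ≤ y n :=
        (((tendsto_rpow_atTop hε).comp tendsto_natCast_atTop_atTop).const_mul_atTop
          hsP).eventually_ge_atTop 2
      -- Where the birthday bound is not available, the error cancels the main term; this affects
      -- only finitely many `n`.
      refine ⟨fun n => if 2 ≤ y n then x n * Real.exp (-(y n / 8)) else x n, ?_, ?_⟩
      · have hlim := tendsto_log_mul_exp_neg_rpow hε (b := √P / 8) (by positivity)
          (2 * (1 - ε) / Real.log (1 / P))
          (div_nonneg (by linarith) (Real.log_pos hbase).le)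
        refine hlim.congr' ?_
        filter_upwards [hy] with n hn
        rw [if_pos hn]
        simp only [x, y, Real.logb]
        congr 1
        · ring
        · congr 1; ring
      · intro n hn
        dsimp only
        split_ifs with h2
        · set m := ⌈x n⌉₊ with hm
          have hx0 : 0 ≤ x n := mul_nonneg (by linarith) (hlogb n hn)
          have hm1 : x n ≤ m := Nat.le_ceil _
          have hm2 : (m : ℝ) ≤ x n + 1 := (Nat.ceil_lt_add_one hx0).le
          have hσ := le_mul_sqrt_pow hP0 hP1 hn hm2
          have hD : distinctProb (Fin n) (X.wordProb s q (m := m)) ≤ Real.exp (-(y n / 8)) := by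
            refine (distinctProb_le_exp (σ := √P ^ m) _ (X.wordProb_nonneg s q)
              (hstar.sum_wordProb q m) (by positivity) ?_ ?_).trans ?_
            · rw [X.sum_wordProb_sq, hP, ← pow_mul, mul_comm, pow_mul, Real.sq_sqrt hP0.le]
            · rw [Fintype.card_fin]; exact h2.trans hσ
            · rw [Fintype.card_fin, Real.exp_le_exp]
              have : y n ≤ n * √P ^ m := hσ
              linarith
          have hexp : Real.exp (-(y n / 8)) ≤ 1 := Real.exp_le_one_iff.2 (by linarith)
          have hreal : x n - x n * Real.exp (-(y n / 8)) ≤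
              m * (1 - distinctProb (Fin n) (X.wordProb s q (m := m))) := by
            rw [← mul_one_sub]
            exact mul_le_mul hm1 (by linarith) (by linarith) (Nat.cast_nonneg m)
          -- The maximum with `0` appears because `ENNReal.ofReal` truncates negative numbers.
          refine (EReal.coe_le_coe_iff.2 (hreal.trans (le_max_left _ 0))).trans ?_
          rw [← EReal.coe_ennreal_ofReal]
          exact EReal.coe_ennreal_le_coe_ennreal_iff.2 (hH n m)
        · have : 2 * (1 - ε) * Real.logb (1 / P) n - x n = 0 := sub_self _
          rw [this]
          exact EReal.coe_ennreal_nonneg _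
  · intro hP1 n hn
    -- The sum of squares is one for every word length, so two draws coincide with probability at
    -- least one half however large `m` is.
    have hhalf : ∀ m : ℕ, ENNReal.ofReal (m / 2) ≤ X.smoothedTrieHeight Set.univ n := by
      intro m
      refine le_trans (ENNReal.ofReal_le_ofReal ?_) (hH n m)
      have hD := distinctProb_le_half (ι := Fin n) (by simpa using hn)
        (X.wordProb s q (m := m)) (X.wordProb_nonneg s q) (hstar.sum_wordProb q m)
        (by rw [X.sum_wordProb_sq, hP, hP1, one_pow])
      nlinarith [(Nat.cast_nonneg m : (0 : ℝ) ≤ m)]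
    refine ENNReal.eq_top_of_forall_nnreal_le fun r => ?_
    obtain ⟨m, hm⟩ := exists_nat_ge (2 * (r : ℝ))
    refine le_trans ?_ (hhalf m)
    rw [← ENNReal.ofReal_coe_nnreal]
    exact ENNReal.ofReal_le_ofReal (by linarith)
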